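/- Let $n\ge 2$ be an integer and let $P=(P_1,\dots,P_n)$ be a tuple of polynomials in $\mathbb C[z_1,\dots,z_n]$ which is positive regular: each $P_j$ has nonnegative coefficients and has the form $P_j(z)=a_jz_j+\sum_{k=2}^{N_j}Q_{jk}(z)$ with $a_j>0$ and $Q_{jk}$ a homogeneous polynomial of degree $k$. Let $m=(m_1,\dots,m_n)$ be a tuple of positive integers. For $z\in\mathbb C\times(\mathbb C\setminus\{0\})^{n-1}$ put $\varphi(z)=(z_1/z_2,\dots,z_{n-1}/z_n,z_n)$, and write $\diamond$ for the coordinatewise product. Let $$\triangle^n_P=\Big\{z\in\mathbb C\times(\mathbb C\setminus\{0\})^{n-1}: P_j\big(\varphi(z)\diamond\overline{\varphi(z)}\big)<1,\ j=1,\dots,n\Big\},$$ and let $\mathscr H^2_m=\mathscr H^2_m(\triangle^n_P)$ be the reproducing kernel Hilbert space of functions on $\triangle^n_P$ with the positive semidefinite kernel $$\mathscr K_{P,m}(z,w)=\prod_{j=2}^n\frac1{z_j\overline w_j}\ \prod_{j=1}^n\frac1{\big(1-P_j(\varphi(z)\diamond\overline{\varphi(w)})\big)^{m_j}}.$$ A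 function $\phi:\triangle^n_P\to\mathbb C$ is a multiplier of $\mathscr H^2_m$ if $\phi f\in\mathscr H^2_m$ for all $f\in\mathscr H^2_m$; it then induces a bounded operator $\mathscr M_\phi f=\phi f$, and the multiplier algebra of $\mathscr H^2_m$ is the algebra of all these operators. Let $H^\infty(\triangle^n_P)$ be the algebra of bounded holomorphic functions on $\triangle^n_P$ with the sup norm. Then the coordinate functions $z_1,\dots,z_n$ are multipliers of $\mathscr H^2_m$. Let $\mathscr M_z=(\mathscr M_{z_1},\dots,\mathscr M_{z_n})$, and let $\{\mathscr M_z\}'$ be the commutant of $\mathscr M_z$, that is, the algebra of all bounded operators on $\mathscr H^2_m$ that commute with every $\mathscr M_{z_j}$. Then: (i) $\{\mathscr M_z\}'$ is a maximal abelian subalgebra of $\mathcal B(\mathscr H^2_m)$; (ii) $\{\mathscr M_z\}'$ is equal to the multiplier algebra of $\mathscr H^2_m$; (iii) $\{\mathscr M_z\}'$ is contractively contained in $H^\infty(\triangle^n_P)$: there is an injective unital algebra homomorphism $\Phi:\{\mathscr M_z\}'\to H^\infty(\triangle^n_P)$ such that $\|\Phi(T)\|_\infty\le\|T\|$ and $Tf=\Phi(T)\,f$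 for all $T\in\{\mathscr M_z\}'$ and $f\in\mathscr H^2_m$. -/

import Mathlib

open scoped ComplexOrder ComplexConjugate Matrix BoundedContinuousFunction

/-! ### Scalar positive semidefinite kernels -/

namespace PSDKernel

variable {X : Type*}

theorem rankOne (f : X → ℂ) :
    (Matrix.of fun x y => f x * conj (f y) : Matrix X X ℂ).PosSemidef := by
  refine ⟨?_, fun v => ?_⟩
  · ext x y
    simp [Matrix.conjTranspose_apply, mul_comm]
  · have h : (v.sum fun i xi => v.sum fun j xj =>
        star xi * (Matrix.of fun x y => f x * conj (f y) : Matrix X X ℂ) i j * xj)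
        = star (v.sum fun j xj => conj (f j) * xj) * (v.sum fun j xj => conj (f j) * xj) := by
      simp only [Finsupp.sum, Matrix.of_apply, star_sum, Finset.sum_mul_sum]
      refine Finset.sum_congr rfl fun i _ => Finset.sum_congr rfl fun j _ => ?_
      simp
      ring
    rw [h]
    exact star_mul_self_nonneg _

theorem mul {k l : X → X → ℂ} (hk : (Matrix.of k).PosSemidef) (hl : (Matrix.of l).PosSemidef) :
    (Matrix.of fun x y => k x y * l x y : Matrix X X ℂ).PosSemidef :=
  hk.hadamard hl

theorem one : (Matrix.of fun _ _ => 1 : Matrix X X ℂ).PosSemidef := by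
  simpa using rankOne (fun _ : X => (1 : ℂ))

theorem pow {k : X → X → ℂ} (hk : (Matrix.of k).PosSemidef) (m : ℕ) :
    (Matrix.of fun x y => k x y ^ m : Matrix X X ℂ).PosSemidef := by
  induction m with
  | zero => simpa using one
  | succ m ih => simpa only [pow_succ] using mul ih hk

theorem prod {ι : Type*} (s : Finset ι) {k : ι → X → X → ℂ}
    (hk : ∀ i ∈ s, (Matrix.of (k i)).PosSemidef) :
    (Matrix.of fun x y => ∏ i ∈ s, k i x y : Matrix X X ℂ).PosSemidef := by
  classical
  induction s using Finset.induction_on with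
  | empty => simpa using one
  | insert a s ha ih =>
    simp only [Finset.prod_insert ha]
    exact mul (hk a (by simp)) (ih fun i hi => hk i (by simp [hi]))

theorem sum {ι : Type*} (s : Finset ι) {k : ι → X → X → ℂ}
    (hk : ∀ i ∈ s, (Matrix.of (k i)).PosSemidef) :
    (Matrix.of fun x y => ∑ i ∈ s, k i x y : Matrix X X ℂ).PosSemidef := by
  have h : (Matrix.of fun x y => ∑ i ∈ s, k i x y : Matrix X X ℂ)
      = ∑ i ∈ s, (Matrix.of (k i) : Matrix X X ℂ) := by
    ext x y
    simp [Matrix.sum_apply]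
  rw [h]
  exact Matrix.posSemidef_sum s hk

theorem limit {k : ℕ → X → X → ℂ} {l : X → X → ℂ}
    (hk : ∀ i, (Matrix.of (k i)).PosSemidef)
    (hl : ∀ x y, Filter.Tendsto (fun i => k i x y) Filter.atTop (nhds (l x y))) :
    (Matrix.of l : Matrix X X ℂ).PosSemidef := by
  refine ⟨?_, fun v => ?_⟩
  · ext x y
    have h1 := (Complex.continuous_conj.tendsto _).comp (hl y x)
    refine tendsto_nhds_unique h1 ((hl x y).congr fun i => ?_)
    have := congrFun (congrFun (hk i).1 x) y
    simpa [Matrix.conjTranspose_apply] using this.symm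
  · have h : Filter.Tendsto (fun i => v.sum fun a xa => v.sum fun b xb =>
        star xa * (Matrix.of (k i)) a b * xb) Filter.atTop
        (nhds (v.sum fun a xa => v.sum fun b xb => star xa * (Matrix.of l) a b * xb)) := by
      simp only [Finsupp.sum]
      refine tendsto_finsetSum _ fun a _ => tendsto_finsetSum _ fun b _ => ?_
      exact ((hl a b).const_mul _).mul_const _
    exact ge_of_tendsto' h fun i => (hk i).2 v

theorem inv_one_sub {k : X → X → ℂ} (hk : (Matrix.of k).PosSemidef)
    (h1 : ∀ x y, ‖k x y‖ < 1) :
    (Matrix.of fun x y => 1 / (1 - k x y) : Matrix X X ℂ).PosSemidef := by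
  refine limit (k := fun N x y => ∑ i ∈ Finset.range N, k x y ^ i)
    (fun N => sum _ fun i _ => pow hk i) fun x y => ?_
  rw [one_div]
  exact (hasSum_geometric_of_norm_lt_one (h1 x y)).tendsto_sum_nat

/-- A scalar kernel, seen as a matrix of operators on the one-dimensional space `ℂ`. -/
noncomputable def toOperator (k : X → X → ℂ) : Matrix X X (ℂ →L[ℂ] ℂ) :=
  Matrix.of fun x y => k x y • ContinuousLinearMap.id ℂ ℂ

theorem toOperator_posSemidef {k : X → X → ℂ} (hk : (Matrix.of k).PosSemidef) :
    (toOperator k).PosSemidef := by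
  have key := (RKHS.posSemidef_tfae (K := toOperator k)).out 0 2
  refine key.mpr ⟨?_, fun v => ?_⟩
  · ext x y
    have h := congrFun (congrFun hk.1 x) y
    have hid : star (ContinuousLinearMap.id ℂ ℂ) = ContinuousLinearMap.id ℂ ℂ :=
      star_one (ℂ →L[ℂ] ℂ)
    simpa [toOperator, Matrix.conjTranspose_apply, star_smul, hid] using h
  · refine le_of_le_of_eq (Complex.le_def.mp (hk.2 v)).1 (congrArg Complex.re ?_)
    refine Finset.sum_congr rfl fun x _ => Finset.sum_congr rfl fun y _ => ?_
    have h : conj (k y x) = k x y := congrFun (congrFun hk.1 x) y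
    simp [toOperator, h]
    ring

end PSDKernel

/-! ### Multipliers of a reproducing kernel Hilbert space -/

section Multipliers

variable {X : Type*} (H : Type*) [NormedAddCommGroup H] [InnerProductSpace ℂ H] [RKHS ℂ H X ℂ]

/-- `φ` is a multiplier of the Hilbert function space `H`: `φ f ∈ H` for every `f ∈ H`. -/
def IsMultiplier (φ : X → ℂ) : Prop :=
  ∀ f : H, ∃ g : H, ∀ x, g x = φ x * f x

variable {H}

/-- Multiplication by a multiplier, as a linear map. -/
noncomputable def multiplicationLinearMap {φ : X → ℂ} (hφ : IsMultiplier H φ) : H →ₗ[ℂ] H where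
  toFun f := (hφ f).choose
  map_add' f g := by
    have h1 := (hφ (f + g)).choose_spec
    have h2 := (hφ f).choose_spec
    have h3 := (hφ g).choose_spec
    refine RKHS.ext fun x => (h1 x).trans ?_
    rw [RKHS.coe_add, Pi.add_apply, mul_add, ← h2 x, ← h3 x]
    exact (congrFun (RKHS.coe_add _ _) x).symm
  map_smul' c f := by
    have h1 := (hφ (c • f)).choose_spec
    have h2 := (hφ f).choose_spec
    refine RKHS.ext fun x => (h1 x).trans ?_
    rw [RKHS.coe_smul, Pi.smul_apply, smul_eq_mul, mul_left_comm, ← h2 x]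
    exact (congrFun (RKHS.coe_smul _ c) x).symm

theorem multiplicationLinearMap_apply {φ : X → ℂ} (hφ : IsMultiplier H φ) (f : H) (x : X) :
    multiplicationLinearMap hφ f x = φ x * f x :=
  (hφ f).choose_spec x

variable [CompleteSpace H]

/-- The bounded operator `M_φ f = φ f` of multiplication by a multiplier `φ`; it is bounded by the
closed graph theorem. -/
noncomputable def multiplicationOperator {φ : X → ℂ} (hφ : IsMultiplier H φ) : H →L[ℂ] H :=
  ContinuousLinearMap.ofSeqClosedGraph (g := multiplicationLinearMap hφ) (by
    intro u f g hu hg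
    refine RKHS.ext fun x => ?_
    have h1 := ((RKHS.continuous_eval (H := H) x).tendsto g).comp hg
    have h2 := (((RKHS.continuous_eval (H := H) x).tendsto f).comp hu).const_mul (φ x)
    rw [multiplicationLinearMap_apply]
    refine tendsto_nhds_unique h1 (h2.congr fun i => ?_)
    simp [multiplicationLinearMap_apply])

theorem multiplicationOperator_apply {φ : X → ℂ} (hφ : IsMultiplier H φ) (f : H) (x : X) :
    multiplicationOperator hφ f x = φ x * f x :=
  multiplicationLinearMap_apply hφ f x

variable (H)

/-- The multiplier algebra `{M_φ : φ is a multiplier of H}`, a subalgebra of `B(H)`. -/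
noncomputable def multiplierAlgebra : Subalgebra ℂ (H →L[ℂ] H) where
  carrier := {T | ∃ (φ : X → ℂ) (hφ : IsMultiplier H φ), T = multiplicationOperator hφ}
  mul_mem' := by
    rintro _ _ ⟨φ, hφ, rfl⟩ ⟨ψ, hψ, rfl⟩
    have h : ∀ (f : H) x, (multiplicationOperator hφ * multiplicationOperator hψ) f x
        = (φ * ψ) x * f x := fun f x => by
      simp [multiplicationOperator_apply, mul_assoc]
    exact ⟨φ * ψ, fun f => ⟨_, h f⟩, ContinuousLinearMap.ext fun f => RKHS.ext fun x =>
      (h f x).trans (multiplicationOperator_apply _ f x).symm⟩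
  add_mem' := by
    rintro _ _ ⟨φ, hφ, rfl⟩ ⟨ψ, hψ, rfl⟩
    have h : ∀ (f : H) x, (multiplicationOperator hφ + multiplicationOperator hψ) f x
        = (φ + ψ) x * f x := fun f x => by
      simp [multiplicationOperator_apply, add_mul]
    exact ⟨φ + ψ, fun f => ⟨_, h f⟩, ContinuousLinearMap.ext fun f => RKHS.ext fun x =>
      (h f x).trans (multiplicationOperator_apply _ f x).symm⟩
  algebraMap_mem' c := by
    have h : ∀ (f : H) x, (algebraMap ℂ (H →L[ℂ] H) c) f x = (fun _ => c) x * f x := fun f x => by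
      simp [Algebra.algebraMap_eq_smul_one]
    exact ⟨fun _ => c, fun f => ⟨_, h f⟩, ContinuousLinearMap.ext fun f => RKHS.ext fun x =>
      (h f x).trans (multiplicationOperator_apply (φ := fun _ => c) (fun f => ⟨_, h f⟩) f x).symm⟩

end Multipliers

/-- A maximal abelian subalgebra: an abelian subalgebra that is not properly contained in another
abelian subalgebra. -/
def IsMaximalAbelian {B : Type*} [Ring B] [Algebra ℂ B] (A : Subalgebra ℂ B) : Prop :=
  Maximal (fun S : Subalgebra ℂ B => ∀ s ∈ S, ∀ t ∈ S, Commute s t) A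

/-- The commutant `{T}'` of a tuple `T = (T_1, …, T_n)` of bounded operators. -/
noncomputable def commutant {H : Type*} [NormedAddCommGroup H] [InnerProductSpace ℂ H] {n : ℕ}
    (T : Fin n → H →L[ℂ] H) : Subalgebra ℂ (H →L[ℂ] H) :=
  Subalgebra.centralizer ℂ (Set.range T)

/-- `H^∞(Ω)`: the algebra of bounded holomorphic functions on `Ω ⊆ ℂⁿ` (for `Ω` open), with the
sup norm inherited from the bounded continuous functions. -/
noncomputable def HInfty {n : ℕ} (Ω : Set (Fin n → ℂ)) : Subalgebra ℂ (Ω →ᵇ ℂ) where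
  carrier := {f | ∃ F : (Fin n → ℂ) → ℂ, DifferentiableOn ℂ F Ω ∧ ∀ z : Ω, f z = F z}
  mul_mem' := by
    rintro f g ⟨F, hF, hf⟩ ⟨G, hG, hg⟩
    exact ⟨fun z => F z * G z, hF.mul hG, fun z => by simp [hf, hg]⟩
  add_mem' := by
    rintro f g ⟨F, hF, hf⟩ ⟨G, hG, hg⟩
    exact ⟨fun z => F z + G z, hF.add hG, fun z => by simp [hf, hg]⟩
  algebraMap_mem' c := ⟨fun _ => c, differentiableOn_const c, fun z => by simp⟩

/-! ### Generalized Hartogs triangles and their Hardy-Hilbert spaces -/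

/-- Each `P_j` has nonnegative coefficients and has the form
`P_j = a_j z_j + Q_2 + ⋯ + Q_N` with `a_j > 0` and `Q_k` homogeneous of degree `k`. -/
def IsPositiveRegular {n : ℕ} (P : Fin n → MvPolynomial (Fin n) ℂ) : Prop :=
  ∀ j, (∀ α, 0 ≤ (P j).coeff α) ∧
    ∃ (a : ℝ) (N : ℕ) (Q : ℕ → MvPolynomial (Fin n) ℂ), 0 < a ∧
      (∀ k, (Q k).IsHomogeneous k) ∧
      P j = MvPolynomial.C (a : ℂ) * MvPolynomial.X j + ∑ k ∈ Finset.Icc 2 N, Q k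

/-- A positive regular polynomial `n`-tuple. -/
structure PositiveRegularTuple (n : ℕ) where
  toFun : Fin n → MvPolynomial (Fin n) ℂ
  isPositiveRegular : IsPositiveRegular toFun

/-- The map `φ(z) = (z_1 / z_2, …, z_{n-1} / z_n, z_n)`. -/
noncomputable def hartogsMap {n : ℕ} (z : Fin n → ℂ) : Fin n → ℂ := fun j =>
  if h : (j : ℕ) + 1 < n then z j / z ⟨j + 1, h⟩ else z j

namespace PositiveRegularTuple

variable {n : ℕ} (P : PositiveRegularTuple n)

/-- The number `P_j(φ(z) ⋄ conj (φ(w)))`, where `⋄` is the coordinatewise product. -/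
noncomputable def polarized (j : Fin n) (z w : Fin n → ℂ) : ℂ :=
  MvPolynomial.eval (fun i => hartogsMap z i * conj (hartogsMap w i)) (P.toFun j)

/-- The generalized Hartogs triangle of `P`: all `z ∈ ℂ × (ℂ \ {0})^(n-1)` such that
`P_j(φ(z) ⋄ conj (φ(z))) < 1` for all `j` (these numbers are real and nonnegative). -/
def triangle : Set (Fin n → ℂ) :=
  {z | (∀ j : Fin n, 0 < (j : ℕ) → z j ≠ 0) ∧ ∀ j, P.polarized j z z < 1}

/-- The kernel `∏_{j ≥ 2} 1 / (z_j conj w_j) ∏_j 1 / (1 - P_j(φ(z) ⋄ conj (φ(w)))) ^ m_j`. -/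
noncomputable def scalarKernel (m : Fin n → ℕ+) (z w : P.triangle) : ℂ :=
  (∏ j ∈ Finset.univ.filter (fun j : Fin n => 0 < (j : ℕ)), 1 / (z.1 j * conj (w.1 j))) *
    ∏ j, 1 / (1 - P.polarized j z.1 w.1) ^ (m j : ℕ)

theorem polarized_eq (j : Fin n) (z w : Fin n → ℂ) :
    P.polarized j z w = ∑ α ∈ (P.toFun j).support, (P.toFun j).coeff α *
      ((∏ i, hartogsMap z i ^ α i) * conj (∏ i, hartogsMap w i ^ α i)) := by
  simp [polarized, MvPolynomial.eval_eq', mul_pow, Finset.prod_mul_distrib]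

theorem norm_polarized_lt_one (j : Fin n) (z w : P.triangle) :
    ‖P.polarized j z.1 w.1‖ < 1 := by
  have hc : ∀ α, (P.toFun j).coeff α = (‖(P.toFun j).coeff α‖ : ℂ) := fun α =>
    (Complex.norm_of_nonneg' ((P.isPositiveRegular j).1 α)).symm
  have hdiag : ∀ z : P.triangle, ∑ α ∈ (P.toFun j).support, ‖(P.toFun j).coeff α‖ *
      ‖∏ i, hartogsMap z.1 i ^ α i‖ ^ 2 < 1 := fun z => by
    have h := z.2.2 j
    have h2 : P.polarized j z.1 z.1 = ((∑ α ∈ (P.toFun j).support, ‖(P.toFun j).coeff α‖ *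
        ‖∏ i, hartogsMap z.1 i ^ α i‖ ^ 2 : ℝ) : ℂ) := by
      rw [polarized_eq, Complex.ofReal_sum]
      refine Finset.sum_congr rfl fun α _ => ?_
      rw [Complex.mul_conj', Complex.ofReal_mul, ← hc, Complex.ofReal_pow]
    rw [h2] at h
    exact_mod_cast h
  have hle : ‖P.polarized j z.1 w.1‖ ≤ ∑ α ∈ (P.toFun j).support,
      (‖(P.toFun j).coeff α‖ * ‖∏ i, hartogsMap z.1 i ^ α i‖ ^ 2 +
        ‖(P.toFun j).coeff α‖ * ‖∏ i, hartogsMap w.1 i ^ α i‖ ^ 2) / 2 := by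
    rw [polarized_eq]
    refine (norm_sum_le _ _).trans (Finset.sum_le_sum fun α _ => ?_)
    rw [norm_mul, norm_mul, RCLike.norm_conj]
    nlinarith [mul_nonneg (norm_nonneg ((P.toFun j).coeff α))
      (sq_nonneg (‖∏ i, hartogsMap z.1 i ^ α i‖ - ‖∏ i, hartogsMap w.1 i ^ α i‖))]
  rw [← Finset.sum_div, Finset.sum_add_distrib] at hle
  linarith [hdiag z, hdiag w]

theorem polarized_posSemidef (j : Fin n) :
    (Matrix.of fun z w : P.triangle => P.polarized j z.1 w.1 :
      Matrix P.triangle P.triangle ℂ).PosSemidef := by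
  simp only [polarized_eq]
  refine PSDKernel.sum _ fun α _ => ?_
  exact (PSDKernel.rankOne fun z : P.triangle => ∏ i, hartogsMap z.1 i ^ α i).smul
    ((P.isPositiveRegular j).1 α)

theorem scalarKernel_posSemidef (m : Fin n → ℕ+) :
    (Matrix.of (P.scalarKernel m)).PosSemidef := by
  refine PSDKernel.mul (PSDKernel.prod _ fun j _ => ?_) (PSDKernel.prod _ fun j _ => ?_)
  · simpa [mul_comm] using PSDKernel.rankOne fun z : P.triangle => (z.1 j)⁻¹
  · simpa using PSDKernel.pow
      (PSDKernel.inv_one_sub (P.polarized_posSemidef j) (P.norm_polarized_lt_one j)) (m j)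

/-- The reproducing kernel of the Hardy-Hilbert space, as a matrix of operators on `ℂ`. -/
noncomputable def kernel (m : Fin n → ℕ+) : Matrix P.triangle P.triangle (ℂ →L[ℂ] ℂ) :=
  PSDKernel.toOperator (P.scalarKernel m)

instance fact_kernel_posSemidef (m : Fin n → ℕ+) : Fact (P.kernel m).PosSemidef :=
  ⟨PSDKernel.toOperator_posSemidef (P.scalarKernel_posSemidef m)⟩

/-- The Hardy-Hilbert space `H²_m` of the generalized Hartogs triangle: the reproducing kernel
Hilbert space of functions on the triangle with the above kernel. -/
abbrev HardySpace (m : Fin n → ℕ+) : Type := RKHS.OfKernel (P.kernel m)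

/-- The coordinate function `z ↦ z_j` on the triangle. -/
def coord (j : Fin n) : P.triangle → ℂ := fun z => z.1 j

/-- The multiplication `n`-tuple `M_z = (M_{z_1}, …, M_{z_n})` on the Hardy-Hilbert space, given
that the coordinate functions are multipliers. -/
noncomputable def multiplicationTuple (m : Fin n → ℕ+)
    (hz : ∀ j, IsMultiplier (P.HardySpace m) (P.coord j)) :
    Fin n → P.HardySpace m →L[ℂ] P.HardySpace m :=
  fun j => multiplicationOperator (hz j)

end PositiveRegularTuple

/-! Write `φ` for `hartogsMap`, `k_w` for the kernel function at `w`, `u = ∏_{j ≥ 2} 1 / z_j` for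
the weight, and `D_w(z) = ∏_j (1 - P_j(φ(z) ⋄ conj φ(w))) ^ m_j`. The kernel formula says `D_w k_w =
conj (u(w)) u`, and the zero-free function `u` takes over the role that the constant function 1 has
in a Hardy space on a ball or polydisc.

Positivity of kernels shows that each component `φ_j` is a multiplier and that multiplication by
`P_j(φ(z) ⋄ conj φ(w))` is a strict contraction (`exists_isMultiplicationBy_hartogsMap`,
`isUnitMultiplier_one_sub_polarized`). So `M_{D_w}` is bounded and invertible, and `u` lies in the
space.

If `T` commutes with the coordinates, it commutes with every `M_{φ_j}`, as `z_{j+1}` has no zeros,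
hence with `M_{D_w}`, a polynomial in the `M_{φ_j}`. Thus `D_w T k_w = conj (u(w)) T u`, that is, `T
k_w = ψ k_w` with `ψ = T u / u`. The adjoint then has all kernel functions as eigenvectors, so `T`
is multiplication by `ψ` (`isMultiplicationBy_symbol`), without any density of polynomials. Parts
(i) and (ii) follow formally. The bound on `ψ` is the bound on eigenvalues of the adjoint, and `ψ`
is holomorphic because `M_{D_w}` has an adjoint that depends holomorphically on `w`
(`exists_differentiableOn_eq_div`). -/

section ScalarRKHS

/-! ### Multiplication operators on a scalar reproducing kernel Hilbert space -/

variable {X H : Type*} [NormedAddCommGroup H] [InnerProductSpace ℂ H] [RKHS ℂ H X ℂ]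

/-- The operator `S` acts as multiplication by the function `φ`. -/
def IsMultiplicationBy (S : H →L[ℂ] H) (φ : X → ℂ) : Prop :=
  ∀ (f : H) (x : X), S f x = φ x * f x

theorem IsMultiplicationBy.isMultiplier {S : H →L[ℂ] H} {φ : X → ℂ}
    (h : IsMultiplicationBy S φ) : IsMultiplier H φ :=
  fun f => ⟨S f, h f⟩

theorem IsMultiplicationBy.unique {S S' : H →L[ℂ] H} {φ : X → ℂ}
    (h : IsMultiplicationBy S φ) (h' : IsMultiplicationBy S' φ) : S = S' :=
  ContinuousLinearMap.ext fun f => RKHS.ext fun x => (h f x).trans (h' f x).symm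

theorem IsMultiplicationBy.mul {S S' : H →L[ℂ] H} {φ φ' : X → ℂ}
    (h : IsMultiplicationBy S φ) (h' : IsMultiplicationBy S' φ') :
    IsMultiplicationBy (S * S') (φ * φ') := fun f x => by
  rw [mul_apply_eq_comp, h, h', Pi.mul_apply, mul_assoc]

theorem IsMultiplicationBy.add {S S' : H →L[ℂ] H} {φ φ' : X → ℂ}
    (h : IsMultiplicationBy S φ) (h' : IsMultiplicationBy S' φ') :
    IsMultiplicationBy (S + S') (φ + φ') := fun f x => by
  rw [add_apply, RKHS.coe_add, Pi.add_apply, h, h', Pi.add_apply, add_mul]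

theorem IsMultiplicationBy.smul {S : H →L[ℂ] H} {φ : X → ℂ} (c : ℂ)
    (h : IsMultiplicationBy S φ) : IsMultiplicationBy (c • S) (c • φ) := fun f x => by
  rw [smul_apply, RKHS.coe_smul, Pi.smul_apply, h, Pi.smul_apply, smul_eq_mul,
    smul_eq_mul, mul_assoc]

theorem IsMultiplicationBy.one : IsMultiplicationBy (1 : H →L[ℂ] H) (1 : X → ℂ) := fun f x => by
  simp

theorem IsMultiplicationBy.zero : IsMultiplicationBy (0 : H →L[ℂ] H) (0 : X → ℂ) := fun f x => by
  simp

theorem IsMultiplicationBy.sum {ι : Type*} (s : Finset ι) {S : ι → H →L[ℂ] H} {φ : ι → X → ℂ}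
    (h : ∀ i ∈ s, IsMultiplicationBy (S i) (φ i)) :
    IsMultiplicationBy (∑ i ∈ s, S i) (∑ i ∈ s, φ i) := by
  classical
  induction s using Finset.induction_on with
  | empty => simpa using IsMultiplicationBy.zero
  | insert a s ha ih =>
    rw [Finset.sum_insert ha, Finset.sum_insert ha]
    exact (h a (by simp)).add (ih fun i hi => h i (by simp [hi]))

theorem IsMultiplicationBy.commute {S S' : H →L[ℂ] H} {φ φ' : X → ℂ}
    (h : IsMultiplicationBy S φ) (h' : IsMultiplicationBy S' φ') : Commute S S' :=
  (h.mul h').unique (mul_comm φ' φ ▸ h'.mul h)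

/-- The multipliers that have an invertible multiplication operator. -/
def IsUnitMultiplier (H : Type*) [NormedAddCommGroup H] [InnerProductSpace ℂ H] [RKHS ℂ H X ℂ]
    (φ : X → ℂ) : Prop :=
  ∃ S : H →L[ℂ] H, IsMultiplicationBy S φ ∧ IsUnit S

theorem IsUnitMultiplier.mul {φ ψ : X → ℂ} (h : IsUnitMultiplier H φ) (h' : IsUnitMultiplier H ψ) :
    IsUnitMultiplier H (φ * ψ) := by
  obtain ⟨S, hS, uS⟩ := h
  obtain ⟨S', hS', uS'⟩ := h'
  exact ⟨S * S', hS.mul hS', uS.mul uS'⟩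

theorem IsUnitMultiplier.one : IsUnitMultiplier H (1 : X → ℂ) :=
  ⟨1, .one, isUnit_one⟩

theorem IsUnitMultiplier.pow {φ : X → ℂ} (h : IsUnitMultiplier H φ) (k : ℕ) :
    IsUnitMultiplier H (φ ^ k) := by
  induction k with
  | zero => simpa using IsUnitMultiplier.one
  | succ k ih => simpa only [pow_succ] using ih.mul h

theorem IsUnitMultiplier.prod {ι : Type*} (s : Finset ι) {φ : ι → X → ℂ}
    (h : ∀ i ∈ s, IsUnitMultiplier H (φ i)) : IsUnitMultiplier H (∏ i ∈ s, φ i) := by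
  classical
  induction s using Finset.induction_on with
  | empty => simpa using IsUnitMultiplier.one
  | insert a s ha ih =>
    rw [Finset.prod_insert ha]
    exact (h a (by simp)).mul (ih fun i hi => h i (by simp [hi]))

/-- The algebra of all functions for which multiplication is a bounded operator commuting with
`T`. -/
def commutingMultipliers (T : H →L[ℂ] H) : Subalgebra ℂ (X → ℂ) where
  carrier := {φ | ∃ S : H →L[ℂ] H, IsMultiplicationBy S φ ∧ Commute T S}
  mul_mem' := by
    rintro φ ψ ⟨S, hS, cS⟩ ⟨S', hS', cS'⟩
    exact ⟨S * S', hS.mul hS', cS.mul_right cS'⟩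
  add_mem' := by
    rintro φ ψ ⟨S, hS, cS⟩ ⟨S', hS', cS'⟩
    exact ⟨S + S', hS.add hS', cS.add_right cS'⟩
  algebraMap_mem' c := by
    refine ⟨c • 1, ?_, (Commute.one_right T).smul_right c⟩
    rw [Algebra.algebraMap_eq_smul_one]
    exact IsMultiplicationBy.one.smul c

theorem aeval_mem_commutingMultipliers {σ : Type*} {T : H →L[ℂ] H} {u : σ → X → ℂ}
    (hu : ∀ i, u i ∈ commutingMultipliers T) (Q : MvPolynomial σ ℂ) :
    MvPolynomial.aeval u Q ∈ commutingMultipliers T := by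
  rw [MvPolynomial.aeval_def, MvPolynomial.eval₂_eq]
  refine Subalgebra.sum_mem _ fun α _ => Subalgebra.mul_mem _ (Subalgebra.algebraMap_mem _ _) ?_
  exact Subalgebra.prod_mem _ fun i _ => Subalgebra.pow_mem _ (hu i) _

variable [CompleteSpace H]

theorem isMultiplicationBy_multiplicationOperator {φ : X → ℂ} (hφ : IsMultiplier H φ) :
    IsMultiplicationBy (multiplicationOperator hφ) φ :=
  multiplicationOperator_apply hφ

theorem kerFun_one_inner (x : X) (f : H) : inner ℂ (RKHS.kerFun H x (1 : ℂ)) f = f x := by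
  simp

theorem denseRange_linearCombination_kerFun :
    DenseRange (Finsupp.linearCombination ℂ fun x : X => RKHS.kerFun H x (1 : ℂ)) := by
  refine (Submodule.dense_iff_topologicalClosure_eq_top.2 (RKHS.kerFun_dense H)).mono
    (Submodule.span_le (p := LinearMap.range _).2 ?_)
  rintro _ ⟨x, v, rfl⟩
  exact ⟨Finsupp.single x v, by
    rw [Finsupp.linearCombination_single, ← map_smul, smul_eq_mul, mul_one]⟩

/-- A function `φ` such that `(C² - φ(x) conj φ(y)) k(x, y)` is positive semidefinite multiplies
with norm at most `C`. -/
theorem exists_isMultiplicationBy_of_posSemidef {φ : X → ℂ} {C : ℝ} (hC : 0 ≤ C)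
    (h : (Matrix.of fun x y => ((C : ℂ) ^ 2 - φ x * conj (φ y)) * RKHS.kerFun H y (1 : ℂ) x :
      Matrix X X ℂ).PosSemidef) :
    ∃ S : H →L[ℂ] H, IsMultiplicationBy S φ ∧ ‖S‖ ≤ C := by
  -- The hypothesis says exactly `‖f v‖ ≤ C ‖e v‖`. So `k_x ↦ conj (φ x) k_x` extends from the dense
  -- span of the kernel functions to a bounded operator, whose adjoint is the multiplication sought.
  set e := Finsupp.linearCombination ℂ fun x : X => RKHS.kerFun H x (1 : ℂ) with he
  set f := Finsupp.linearCombination ℂ fun x : X => conj (φ x) • RKHS.kerFun H x (1 : ℂ) with hf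
  have hnorm : ∀ v, ‖f v‖ ≤ C * ‖e v‖ := fun v => by
    have h2 := h.2 v
    have key : (v.sum fun i xi => v.sum fun j xj => star xi * (Matrix.of fun x y =>
        ((C : ℂ) ^ 2 - φ x * conj (φ y)) * RKHS.kerFun H y (1 : ℂ) x : Matrix X X ℂ) i j * xj)
        = (C : ℂ) ^ 2 * inner ℂ (e v) (e v) - inner ℂ (f v) (f v) := by
      simp only [he, hf, Finsupp.linearCombination_apply, Finsupp.sum, sum_inner, inner_sum,
        inner_smul_left, inner_smul_right, kerFun_one_inner, Matrix.of_apply, Finset.mul_sum,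
        ← Finset.sum_sub_distrib]
      rw [Finset.sum_comm]
      refine Finset.sum_congr rfl fun x _ => Finset.sum_congr rfl fun y _ => ?_
      simp
      ring
    rw [key, inner_self_eq_norm_sq_to_K, inner_self_eq_norm_sq_to_K] at h2
    have h3 : 0 ≤ C ^ 2 * ‖e v‖ ^ 2 - ‖f v‖ ^ 2 := by
      rw [← Complex.zero_le_real]
      push_cast
      exact h2
    refine le_of_sq_le_sq ?_ (by positivity)
    nlinarith
  have hd : DenseRange e := denseRange_linearCombination_kerFun
  set A := f.extendOfNorm e with hA
  have hAk : ∀ x : X, A (RKHS.kerFun H x (1 : ℂ)) = conj (φ x) • RKHS.kerFun H x (1 : ℂ) := by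
    intro x
    have := LinearMap.extendOfNorm_eq hd ⟨C, hnorm⟩ (Finsupp.single x 1)
    simpa [he, hf] using this
  refine ⟨A.adjoint, fun g x => ?_, ?_⟩
  · rw [← kerFun_one_inner x (A.adjoint g), ContinuousLinearMap.adjoint_inner_right, hAk,
      inner_smul_left, kerFun_one_inner, Complex.conj_conj]
  · rw [LinearIsometryEquiv.norm_map]
    exact LinearMap.opNorm_extendOfNorm_le hd hC hnorm

/-- The adjoint of a multiplication operator acts diagonally on the kernel functions. -/
theorem IsMultiplicationBy.adjoint_kerFun {S : H →L[ℂ] H} {φ : X → ℂ}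
    (h : IsMultiplicationBy S φ) (x : X) :
    S.adjoint (RKHS.kerFun H x (1 : ℂ)) = conj (φ x) • RKHS.kerFun H x (1 : ℂ) := by
  refine ext_inner_right ℂ fun f => ?_
  rw [ContinuousLinearMap.adjoint_inner_left, kerFun_one_inner, h, inner_smul_left,
    kerFun_one_inner, Complex.conj_conj]

/-- The adjoint of `S` has the eigenvalue `conj (φ x)` with eigenvector `k_x`, which is nonzero as
soon as some function in the space does not vanish at `x`. -/
theorem IsMultiplicationBy.norm_apply_le {S : H →L[ℂ] H} {φ : X → ℂ}
    (h : IsMultiplicationBy S φ) {x : X} (hx : ∃ f : H, f x ≠ 0) : ‖φ x‖ ≤ ‖S‖ := by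
  have hk : (RKHS.kerFun H x (1 : ℂ) : H) ≠ 0 := fun h0 => by
    obtain ⟨f, hf⟩ := hx
    rw [← kerFun_one_inner, h0, inner_zero_left] at hf
    exact hf rfl
  have h1 := S.adjoint.le_opNorm (RKHS.kerFun H x (1 : ℂ))
  rw [h.adjoint_kerFun, norm_smul, RCLike.norm_conj, LinearIsometryEquiv.norm_map] at h1
  exact le_of_mul_le_mul_right h1 (norm_pos_iff.2 hk)

/-- An operator that acts on the kernel functions as multiplication by `ψ` does so everywhere. -/
theorem isMultiplicationBy_of_kerFun {T : H →L[ℂ] H} {ψ : X → ℂ}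
    (h : ∀ w z : X, T (RKHS.kerFun H w (1 : ℂ)) z = ψ z * RKHS.kerFun H w (1 : ℂ) z) :
    IsMultiplicationBy T ψ := by
  intro f z
  -- By Hermitian symmetry, `(T* k_z)(w) = conj ((T k_w)(z)) = conj (ψ z) k_z(w)`. The eigenvector
  -- equation for `T*` therefore holds pointwise.
  have hk : T.adjoint (RKHS.kerFun H z (1 : ℂ)) = conj (ψ z) • RKHS.kerFun H z (1 : ℂ) := by
    refine RKHS.ext fun w => ?_
    rw [RKHS.coe_smul, Pi.smul_apply, ← kerFun_one_inner w, ← kerFun_one_inner w,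
      ContinuousLinearMap.adjoint_inner_right, ← inner_conj_symm, kerFun_one_inner, h,
      ← inner_conj_symm (RKHS.kerFun H w (1 : ℂ)), kerFun_one_inner, map_mul, smul_eq_mul]
  rw [← kerFun_one_inner, ← ContinuousLinearMap.adjoint_inner_left, hk, inner_smul_left,
    kerFun_one_inner, Complex.conj_conj]

end ScalarRKHS

/-! ### Cauchy-Schwarz for scalar kernels -/

section KernelEstimates

variable {X : Type*}

theorem kerFun_ofKernel_toOperator {k : X → X → ℂ} [Fact (PSDKernel.toOperator k).PosSemidef]
    (x y : X) : RKHS.kerFun (RKHS.OfKernel (PSDKernel.toOperator k)) y (1 : ℂ) x = k x y := by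
  rw [RKHS.kerFun_apply, RKHS.OfKernel.kernel_ofKernel]
  simp [PSDKernel.toOperator]

/-- The Cauchy-Schwarz inequality for a positive semidefinite kernel. -/
theorem PSDKernel.cauchySchwarz {k : X → X → ℂ} (hk : (Matrix.of k).PosSemidef) (w : X) :
    (Matrix.of fun x y => k w w * k x y - k x w * k w y : Matrix X X ℂ).PosSemidef := by
  have hconj : ∀ x y, conj (k y x) = k x y := fun x y => congrFun (congrFun hk.1 x) y
  refine ⟨?_, fun v => ?_⟩
  · ext x y
    simp [Matrix.conjTranspose_apply, hconj, mul_comm]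
  · have : Fact (PSDKernel.toOperator k).PosSemidef := ⟨PSDKernel.toOperator_posSemidef hk⟩
    -- With `k` realised as the Gram matrix of the vectors `κ x`, the quadratic form becomes `‖κ w‖²
    -- ‖s‖² - |⟨κ w, s⟩|²`.
    let κ : X → RKHS.OfKernel (PSDKernel.toOperator k) := fun x => RKHS.kerFun _ x (1 : ℂ)
    have hκ : ∀ x y, inner ℂ (κ x) (κ y) = k x y := fun x y =>
      (kerFun_one_inner x _).trans (kerFun_ofKernel_toOperator x y)
    set s := v.sum fun x c => c • κ x with hs
    have key : (v.sum fun i xi => v.sum fun j xj => star xi * (Matrix.of fun x y =>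
        k w w * k x y - k x w * k w y : Matrix X X ℂ) i j * xj)
        = inner ℂ (κ w) (κ w) * inner ℂ s s - conj (inner ℂ (κ w) s) * inner ℂ (κ w) s := by
      simp only [inner_conj_symm]
      have hss : inner ℂ s s = ∑ x ∈ v.support, ∑ y ∈ v.support, conj (v x) * (v y * k x y) := by
        simp only [hs, Finsupp.sum, sum_inner, inner_sum, inner_smul_left, inner_smul_right, hκ]
        rw [Finset.sum_comm]
        refine Finset.sum_congr rfl fun x _ => ?_
        rw [Finset.mul_sum]
        refine Finset.sum_congr rfl fun y _ => ?_
        ring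
      rw [hss]
      simp only [hs, Finsupp.sum, sum_inner, inner_sum, inner_smul_left, inner_smul_right,
        hκ, Finset.sum_mul_sum]
      simp only [Finset.mul_sum]
      rw [← Finset.sum_sub_distrib]
      refine Finset.sum_congr rfl fun x _ => ?_
      rw [← Finset.sum_sub_distrib]
      refine Finset.sum_congr rfl fun y _ => ?_
      simp
      ring
    rw [key, Complex.conj_mul', inner_self_eq_norm_sq_to_K, inner_self_eq_norm_sq_to_K]
    have h := norm_inner_le_norm (𝕜 := ℂ) (κ w) s
    have h2 : 0 ≤ ‖κ w‖ ^ 2 * ‖s‖ ^ 2 - ‖(inner ℂ (κ w) s : ℂ)‖ ^ 2 := by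
      rw [← mul_pow, sub_nonneg]
      exact pow_le_pow_left₀ (norm_nonneg _) h 2
    rw [← Complex.zero_le_real] at h2
    push_cast at h2
    exact h2

end KernelEstimates

/-! ### Multiplier estimates from positivity of kernels -/

namespace PositiveRegularTuple

variable {n : ℕ} (P : PositiveRegularTuple n) (m : Fin n → ℕ+)

theorem kerFun_hardySpace (z w : P.triangle) :
    RKHS.kerFun (P.HardySpace m) w (1 : ℂ) z = P.scalarKernel m z w :=
  letI : Fact (PSDKernel.toOperator (P.scalarKernel m)).PosSemidef := P.fact_kernel_posSemidef m
  kerFun_ofKernel_toOperator z w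

theorem conj_polarized (j : Fin n) (z w : P.triangle) :
    conj (P.polarized j w.1 z.1) = P.polarized j z.1 w.1 :=
  congrFun (congrFun (P.polarized_posSemidef j).1 z) w

theorem one_sub_polarized_ne_zero (j : Fin n) (z w : P.triangle) :
    1 - P.polarized j z.1 w.1 ≠ 0 := fun h => by
  have := P.norm_polarized_lt_one j z w
  rw [← sub_eq_zero.1 h, norm_one] at this
  exact lt_irrefl _ this

/-- Since `m_j ≥ 1`, the factor `1 - P_j` cancels one of the `m_j` copies of its inverse in the
kernel; what is left is still a product of positive semidefinite kernels. -/
theorem one_sub_polarized_mul_scalarKernel_posSemidef (j : Fin n) :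
    (Matrix.of fun z w : P.triangle => (1 - P.polarized j z.1 w.1) * P.scalarKernel m z w :
      Matrix P.triangle P.triangle ℂ).PosSemidef := by
  have h : ∀ z w : P.triangle, (1 - P.polarized j z.1 w.1) * P.scalarKernel m z w =
      (∏ j ∈ Finset.univ.filter (fun j : Fin n => 0 < (j : ℕ)), 1 / (z.1 j * conj (w.1 j))) *
      ((1 / (1 - P.polarized j z.1 w.1)) ^ ((m j : ℕ) - 1) *
        ∏ i ∈ Finset.univ.erase j, (1 / (1 - P.polarized i z.1 w.1)) ^ (m i : ℕ)) := fun z w => by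
    rw [scalarKernel, ← Finset.mul_prod_erase _ _ (Finset.mem_univ j)]
    have h0 := P.one_sub_polarized_ne_zero j z w
    have hm : ((1 : ℂ) - P.polarized j z.1 w.1) * (1 / (1 - P.polarized j z.1 w.1) ^ (m j : ℕ)) =
        (1 / (1 - P.polarized j z.1 w.1)) ^ ((m j : ℕ) - 1) := by
      obtain ⟨k, hk⟩ := Nat.exists_eq_succ_of_ne_zero (m j).ne_zero
      rw [hk, Nat.succ_sub_one, one_div_pow, Nat.succ_eq_add_one, pow_succ]
      field_simp
    rw [← hm]
    simp only [one_div_pow]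
    ring
  simp only [h]
  have hP := fun j => PSDKernel.inv_one_sub (P.polarized_posSemidef j) (P.norm_polarized_lt_one j)
  refine PSDKernel.mul (PSDKernel.prod _ fun j _ => ?_)
    (PSDKernel.mul (PSDKernel.pow (hP j) _) (PSDKernel.prod _ fun i _ => PSDKernel.pow (hP i) _))
  simpa [mul_comm] using PSDKernel.rankOne fun z : P.triangle => (z.1 j)⁻¹

theorem exists_coeff_single (j : Fin n) :
    ∃ a : ℝ, 0 < a ∧ (P.toFun j).coeff (Finsupp.single j 1) = a := by
  obtain ⟨-, a, N, Q, ha, hQ, hP⟩ := P.isPositiveRegular j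
  refine ⟨a, ha, ?_⟩
  rw [hP, MvPolynomial.coeff_add, MvPolynomial.coeff_C_mul, MvPolynomial.coeff_X,
    MvPolynomial.coeff_sum, Finset.sum_eq_zero, if_pos rfl, mul_one, add_zero]
  intro k hk
  refine (hQ k).coeff_eq_zero ?_
  rw [Finsupp.degree_single]
  have := (Finset.mem_Icc.1 hk).1
  omega

/-- Deleting the monomial `a_j z_j` from `P_j` leaves nonnegative coefficients, hence a nonnegative
combination of rank-one kernels. -/
theorem polarized_sub_posSemidef (j : Fin n) :
    (Matrix.of fun z w : P.triangle => P.polarized j z.1 w.1 -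
      (P.toFun j).coeff (Finsupp.single j 1) * (hartogsMap z.1 j * conj (hartogsMap w.1 j)) :
      Matrix P.triangle P.triangle ℂ).PosSemidef := by
  obtain ⟨a, ha, hc⟩ := P.exists_coeff_single j
  have hmem : Finsupp.single j 1 ∈ (P.toFun j).support := by
    rw [MvPolynomial.mem_support_iff, hc]
    exact_mod_cast ha.ne'
  have hprod : ∀ z : Fin n → ℂ, ∏ i, hartogsMap z i ^ (Finsupp.single j 1 : Fin n →₀ ℕ) i =
      hartogsMap z j := fun z => by
    rw [Finset.prod_eq_single j]
    · simp
    · intro i _ hi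
      simp [Finsupp.single_eq_of_ne hi]
    · simp
  have h : ∀ z w : P.triangle, P.polarized j z.1 w.1 -
      (P.toFun j).coeff (Finsupp.single j 1) * (hartogsMap z.1 j * conj (hartogsMap w.1 j)) =
      ∑ α ∈ (P.toFun j).support.erase (Finsupp.single j 1), (P.toFun j).coeff α *
      ((∏ i, hartogsMap z.1 i ^ α i) * conj (∏ i, hartogsMap w.1 i ^ α i)) := fun z w => by
    rw [polarized_eq, ← Finset.add_sum_erase _ _ hmem, hprod, hprod, add_sub_cancel_left]
  simp only [h]
  refine PSDKernel.sum _ fun α _ => ?_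
  exact (PSDKernel.rankOne fun z : P.triangle => ∏ i, hartogsMap z.1 i ^ α i).smul
    ((P.isPositiveRegular j).1 α)

/-- With `a` the linear coefficient of `P_j` and `K` the kernel, `(1 - a φ_j conj φ_j) K = (1 - P_j)
K + (P_j - a φ_j conj φ_j) K`, and both summands are positive semidefinite. Division by `a` gives
the norm bound `1 / √a`. -/
theorem exists_isMultiplicationBy_hartogsMap (j : Fin n) :
    ∃ S : P.HardySpace m →L[ℂ] P.HardySpace m,
      IsMultiplicationBy S fun z : P.triangle => hartogsMap z.1 j := by
  obtain ⟨a, ha, hc⟩ := P.exists_coeff_single j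
  obtain ⟨S, hS, -⟩ := exists_isMultiplicationBy_of_posSemidef (H := P.HardySpace m)
    (φ := fun z : P.triangle => hartogsMap z.1 j) (C := (√a)⁻¹) (by positivity) (by
      have hsa : (((√a)⁻¹ : ℝ) : ℂ) ^ 2 = (a : ℂ)⁻¹ := by
        rw [← Complex.ofReal_pow, inv_pow, Real.sq_sqrt ha.le, Complex.ofReal_inv]
      have h1 := ((P.one_sub_polarized_mul_scalarKernel_posSemidef m j).add
        (PSDKernel.mul (P.polarized_sub_posSemidef j) (P.scalarKernel_posSemidef m))).smul
        (show (0 : ℂ) ≤ (a : ℂ)⁻¹ by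
          rw [← Complex.ofReal_inv, Complex.zero_le_real]; positivity)
      convert h1 using 1
      ext z w
      have ha' : (a : ℂ) ≠ 0 := by exact_mod_cast ha.ne'
      simp only [kerFun_hardySpace, Matrix.of_apply, Matrix.smul_apply, Matrix.add_apply, hsa, hc,
        smul_eq_mul]
      field_simp
      ring)
  exact ⟨S, hS⟩

/-- Let `p(z) = P_j(z, w)` be the polarized function and `r = p(w) < 1`. Then `(r - p(z) conj p(v))
K` is the sum of `r (1 - P_j(z, v)) K` and `(r P_j(z, v) - P_j(z, w) P_j(w, v)) K`; the second is
positive semidefinite by Cauchy-Schwarz. So multiplication by `p` has norm at most `√r < 1`, and a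
Neumann series inverts `1 - p`. -/
theorem isUnitMultiplier_one_sub_polarized (j : Fin n) (w : P.triangle) :
    IsUnitMultiplier (P.HardySpace m) fun z : P.triangle => 1 - P.polarized j z.1 w.1 := by
  set r := ‖P.polarized j w.1 w.1‖ with hr
  have hrw : P.polarized j w.1 w.1 = r := by
    refine (Complex.norm_of_nonneg' ?_).symm
    exact (P.polarized_posSemidef j).diag_nonneg (i := w)
  have hr1 : r < 1 := P.norm_polarized_lt_one j w w
  obtain ⟨S, hS, hSn⟩ := exists_isMultiplicationBy_of_posSemidef (H := P.HardySpace m)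
    (φ := fun z : P.triangle => P.polarized j z.1 w.1) (C := √r) (Real.sqrt_nonneg _) (by
      have hsr : ((√r : ℝ) : ℂ) ^ 2 = r := by
        rw [← Complex.ofReal_pow, Real.sq_sqrt (norm_nonneg _)]
      have h1 := ((P.one_sub_polarized_mul_scalarKernel_posSemidef m j).smul
        (show (0 : ℂ) ≤ r by rw [Complex.zero_le_real]; exact norm_nonneg _)).add
        (PSDKernel.mul (PSDKernel.cauchySchwarz (P.polarized_posSemidef j) w)
          (P.scalarKernel_posSemidef m))
      convert h1 using 1
      ext z v
      simp only [kerFun_hardySpace, Matrix.of_apply, Matrix.smul_apply, Matrix.add_apply, hsr,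
        smul_eq_mul, conj_polarized, hrw]
      ring)
  refine ⟨1 - S, fun f z => ?_, isUnit_one_sub_of_norm_lt_one (hSn.trans_lt ?_)⟩
  · rw [sub_apply, one_apply_eq_self, RKHS.coe_sub, Pi.sub_apply, hS, sub_mul, one_mul]
  · rw [Real.sqrt_lt' one_pos]
    simpa using hr1

end PositiveRegularTuple

/-! ### The coordinate multipliers and their commutant -/

namespace PositiveRegularTuple

variable {n : ℕ} (P : PositiveRegularTuple n) (m : Fin n → ℕ+)

theorem coord_eq_hartogsMap_mul (z : P.triangle) {j : Fin n} (h : (j : ℕ) + 1 < n) :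
    P.coord j z = hartogsMap z.1 j * P.coord ⟨j + 1, h⟩ z := by
  have h0 : z.1 ⟨j + 1, h⟩ ≠ 0 := z.2.1 _ (Nat.succ_pos _)
  rw [hartogsMap, dif_pos h, coord, coord, div_mul_cancel₀ _ h0]

theorem coord_eq_hartogsMap (z : P.triangle) {j : Fin n} (h : ¬ (j : ℕ) + 1 < n) :
    P.coord j z = hartogsMap z.1 j := by
  rw [hartogsMap, dif_neg h, coord]

/-- Descending recursion along `z_j = φ_j z_{j+1}`, starting from `z_n = φ_n`. -/
theorem exists_isMultiplicationBy_coord (j : Fin n) :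
    ∃ S : P.HardySpace m →L[ℂ] P.HardySpace m, IsMultiplicationBy S (P.coord j) := by
  obtain ⟨S, hS⟩ := P.exists_isMultiplicationBy_hartogsMap m j
  by_cases h : (j : ℕ) + 1 < n
  · obtain ⟨S', hS'⟩ := exists_isMultiplicationBy_coord ⟨j + 1, h⟩
    refine ⟨S * S', ?_⟩
    rw [show P.coord j = (fun z : P.triangle => hartogsMap z.1 j) * P.coord ⟨j + 1, h⟩ from
      funext fun z => P.coord_eq_hartogsMap_mul z h]
    exact hS.mul hS'
  · refine ⟨S, ?_⟩
    rwa [show P.coord j = fun z : P.triangle => hartogsMap z.1 j from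
      funext fun z => P.coord_eq_hartogsMap z h]
termination_by n - j

theorem isMultiplier_coord (j : Fin n) : IsMultiplier (P.HardySpace m) (P.coord j) :=
  (P.exists_isMultiplicationBy_coord m j).choose_spec.isMultiplier

theorem mem_commutant_multiplicationTuple
    {hz : ∀ j, IsMultiplier (P.HardySpace m) (P.coord j)}
    {T : P.HardySpace m →L[ℂ] P.HardySpace m} :
    T ∈ commutant (P.multiplicationTuple m hz) ↔
      ∀ j (f : P.HardySpace m) (z : P.triangle),
        T (multiplicationOperator (hz j) f) z = P.coord j z * T f z := by
  rw [commutant, Subalgebra.mem_centralizer_iff, Set.forall_mem_range]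
  refine forall_congr' fun j => ⟨fun h f z => ?_, fun h => ?_⟩
  · rw [← multiplicationOperator_apply (hz j) (T f) z]
    exact (DFunLike.congr_fun (DFunLike.congr_fun h f) z).symm
  · refine ContinuousLinearMap.ext fun f => RKHS.ext fun z => ?_
    exact (multiplicationOperator_apply (hz j) (T f) z).trans (h f z).symm

/-- An operator commuting with the coordinates commutes with the components of `hartogsMap`. -/
theorem hartogsMap_mem_commutingMultipliers
    {hz : ∀ j, IsMultiplier (P.HardySpace m) (P.coord j)}
    {T : P.HardySpace m →L[ℂ] P.HardySpace m} (hT : T ∈ commutant (P.multiplicationTuple m hz))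
    (j : Fin n) : (fun z : P.triangle => hartogsMap z.1 j) ∈ commutingMultipliers T := by
  rw [mem_commutant_multiplicationTuple] at hT
  obtain ⟨S, hS⟩ := P.exists_isMultiplicationBy_hartogsMap m j
  refine ⟨S, hS, ContinuousLinearMap.ext fun f => RKHS.ext fun z => ?_⟩
  rw [mul_apply_eq_comp, mul_apply_eq_comp, hS]
  by_cases h : (j : ℕ) + 1 < n
  -- Here `M_{z_{j+1}} S = M_{z_j}`. Commutation of `T` with both coordinates gives `z_{j+1} T S f =
  -- z_{j+1} φ_j T f`, and `z_{j+1}` never vanishes on the triangle.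
  · have h0 : P.coord ⟨j + 1, h⟩ z ≠ 0 := z.2.1 _ (Nat.succ_pos _)
    have hcomp : multiplicationOperator (hz ⟨j + 1, h⟩) (S f) = multiplicationOperator (hz j) f :=
      RKHS.ext fun x => by
        rw [multiplicationOperator_apply, multiplicationOperator_apply, hS,
          P.coord_eq_hartogsMap_mul x h]
        ring
    refine mul_left_cancel₀ h0 ?_
    rw [← hT, hcomp, hT, P.coord_eq_hartogsMap_mul z h]
    ring
  · have hcomp : S f = multiplicationOperator (hz j) f := RKHS.ext fun x => by
      rw [multiplicationOperator_apply, hS, P.coord_eq_hartogsMap x h]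
    rw [hcomp, hT, P.coord_eq_hartogsMap z h]

/-! ### The weight vector and the symbol of an operator -/

/-- The function `∏_{j ≥ 2} 1 / z_j`. -/
noncomputable def weight (z : P.triangle) : ℂ :=
  ∏ j ∈ Finset.univ.filter (fun j : Fin n => 0 < (j : ℕ)), (z.1 j)⁻¹

theorem weight_ne_zero (z : P.triangle) : P.weight z ≠ 0 :=
  Finset.prod_ne_zero_iff.2 fun j hj => inv_ne_zero (z.2.1 j (Finset.mem_filter.1 hj).2)

/-- The polynomial `∏_j (1 - P_j) ^ m_j`. -/
noncomputable def denominator : MvPolynomial (Fin n) ℂ :=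
  ∏ j, (1 - P.toFun j) ^ (m j : ℕ)

/-- The polarization of `∏_j (1 - P_j) ^ m_j`, as a function of the first variable. -/
noncomputable def denominatorFun (w : P.triangle) : P.triangle → ℂ :=
  ∏ j, (fun z : P.triangle => 1 - P.polarized j z.1 w.1) ^ (m j : ℕ)

theorem denominatorFun_apply (w z : P.triangle) :
    P.denominatorFun m w z = ∏ j, (1 - P.polarized j z.1 w.1) ^ (m j : ℕ) := by
  simp [denominatorFun, Finset.prod_apply]

theorem denominatorFun_ne_zero (w z : P.triangle) : P.denominatorFun m w z ≠ 0 := by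
  rw [denominatorFun_apply]
  exact Finset.prod_ne_zero_iff.2 fun j _ => pow_ne_zero _ (P.one_sub_polarized_ne_zero j z w)

theorem isUnitMultiplier_denominatorFun (w : P.triangle) :
    IsUnitMultiplier (P.HardySpace m) (P.denominatorFun m w) :=
  .prod _ fun j _ => (P.isUnitMultiplier_one_sub_polarized m j w).pow _

theorem denominatorFun_eq_eval (w z : P.triangle) : P.denominatorFun m w z =
    MvPolynomial.eval (fun i => hartogsMap z.1 i * conj (hartogsMap w.1 i))
      (P.denominator m) := by
  simp [denominatorFun_apply, denominator, polarized, map_prod]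

/-- Clearing denominators makes all kernel functions multiples of one zero-free function; this links
the values of an operator on different kernel functions. -/
theorem denominatorFun_mul_kerFun (w z : P.triangle) :
    P.denominatorFun m w z * RKHS.kerFun (P.HardySpace m) w (1 : ℂ) z =
      conj (P.weight w) * P.weight z := by
  have h : P.scalarKernel m z w = P.weight z * conj (P.weight w) *
      (P.denominatorFun m w z)⁻¹ := by
    rw [scalarKernel, denominatorFun_apply, weight, weight, map_prod, ← Finset.prod_mul_distrib,
      ← Finset.prod_inv_distrib]
    simp [mul_comm]
  rw [kerFun_hardySpace, h, mul_comm, mul_assoc, inv_mul_cancel₀ (P.denominatorFun_ne_zero m w z)]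
  ring

/-- For any single point `w`, the space contains `D_w k_w`, a nonzero multiple of the weight. An
empty triangle is vacuous. -/
theorem exists_weight_mem : ∃ f : P.HardySpace m, ∀ z, f z = P.weight z := by
  by_cases h : Nonempty P.triangle
  · obtain ⟨w⟩ := h
    obtain ⟨S, hS, -⟩ := P.isUnitMultiplier_denominatorFun m w
    refine ⟨(conj (P.weight w))⁻¹ • S (RKHS.kerFun (P.HardySpace m) w (1 : ℂ)), fun z => ?_⟩
    rw [RKHS.coe_smul, Pi.smul_apply, hS, denominatorFun_mul_kerFun, smul_eq_mul,
      inv_mul_cancel_left₀ ((map_ne_zero _).2 (P.weight_ne_zero w))]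
  · exact ⟨0, fun z => (h ⟨z⟩).elim⟩

/-- The function `∏_{j ≥ 2} 1 / z_j` as an element of the Hardy space. -/
noncomputable def weightVector : P.HardySpace m := (P.exists_weight_mem m).choose

theorem weightVector_apply (z : P.triangle) : P.weightVector m z = P.weight z :=
  (P.exists_weight_mem m).choose_spec z

theorem weightVector_ne_zero (z : P.triangle) : P.weightVector m z ≠ 0 :=
  P.weightVector_apply m z ▸ P.weight_ne_zero z

theorem apply_kerFun_of_isMultiplicationBy {w : P.triangle}
    {S : P.HardySpace m →L[ℂ] P.HardySpace m}
    (hS : IsMultiplicationBy S (P.denominatorFun m w)) :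
    S (RKHS.kerFun (P.HardySpace m) w (1 : ℂ)) = conj (P.weight w) • P.weightVector m :=
  RKHS.ext fun z => by
    rw [hS, denominatorFun_mul_kerFun, RKHS.coe_smul, Pi.smul_apply, weightVector_apply,
      smul_eq_mul]

/-- The function that an operator in the commutant of `M_z` multiplies by. -/
noncomputable def symbol (T : P.HardySpace m →L[ℂ] P.HardySpace m) (z : P.triangle) : ℂ :=
  T (P.weightVector m) z / P.weightVector m z

theorem symbol_mul_weightVector (T : P.HardySpace m →L[ℂ] P.HardySpace m) (z : P.triangle) :
    P.symbol m T z * P.weightVector m z = T (P.weightVector m) z :=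
  div_mul_cancel₀ _ (P.weightVector_ne_zero m z)

/-- Evaluation on the zero-free weight vector determines the function. Hence sums and products of
operators have the expected symbols. -/
theorem eq_symbol {T : P.HardySpace m →L[ℂ] P.HardySpace m} {φ : P.triangle → ℂ}
    (h : IsMultiplicationBy T φ) : φ = P.symbol m T :=
  funext fun z => (div_eq_of_eq_mul (P.weightVector_ne_zero m z) (h _ z)).symm

theorem isMultiplicationBy_symbol {hz : ∀ j, IsMultiplier (P.HardySpace m) (P.coord j)}
    {T : P.HardySpace m →L[ℂ] P.HardySpace m} (hT : T ∈ commutant (P.multiplicationTuple m hz)) :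
    IsMultiplicationBy T (P.symbol m T) := by
  refine isMultiplicationBy_of_kerFun fun w z => ?_
  have hmem : P.denominatorFun m w ∈ commutingMultipliers T := by
    -- For fixed `w` the numbers `conj (φ_i(w))` are constants, so `D_w` is a polynomial in the
    -- functions `φ_i`.
    have h : P.denominatorFun m w = MvPolynomial.aeval
        (fun i => conj (hartogsMap w.1 i) • fun z : P.triangle => hartogsMap z.1 i)
        (P.denominator m) := funext fun z => by
      rw [denominatorFun_eq_eval, MvPolynomial.aeval_def, MvPolynomial.eval₂_eq',
        MvPolynomial.eval_eq']
      simp [Finset.sum_apply, Finset.prod_apply, mul_comm]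
    rw [h]
    exact aeval_mem_commutingMultipliers (fun i => Subalgebra.smul_mem _
      (P.hartogsMap_mem_commutingMultipliers m hT i) _) _
  obtain ⟨S, hS, hTS⟩ := hmem
  refine mul_left_cancel₀ (P.denominatorFun_ne_zero m w z) ?_
  rw [← hS, mul_left_comm, denominatorFun_mul_kerFun, ← mul_apply_eq_comp, ← hTS.eq,
    mul_apply_eq_comp, P.apply_kerFun_of_isMultiplicationBy m hS, map_smul, RKHS.coe_smul,
    Pi.smul_apply, smul_eq_mul, ← symbol_mul_weightVector, weightVector_apply]
  ring

/-! ### Holomorphy of the symbol -/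

theorem differentiableOn_hartogsMap (i : Fin n) :
    DifferentiableOn ℂ (fun z : Fin n → ℂ => hartogsMap z i) P.triangle := by
  have hd : ∀ j, DifferentiableOn ℂ (fun z : Fin n → ℂ => z j) P.triangle := fun j =>
    (differentiable_apply j).differentiableOn
  unfold hartogsMap
  split_ifs with h
  · simp only [div_eq_mul_inv]
    exact (hd i).mul ((hd _).inv fun z hz => hz.1 _ (Nat.succ_pos _))
  · exact hd i

theorem differentiableOn_prod_hartogsMap_pow (s : Finset (Fin n)) (α : Fin n → ℕ) :
    DifferentiableOn ℂ (fun z : Fin n → ℂ => ∏ i ∈ s, hartogsMap z i ^ α i) P.triangle := by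
  classical
  induction s using Finset.induction_on with
  | empty => simp only [Finset.prod_empty]; exact differentiableOn_const 1
  | insert a s ha ih =>
    simp only [Finset.prod_insert ha]
    exact ((P.differentiableOn_hartogsMap a).pow _).mul ih

theorem exists_isMultiplicationBy_monomial (α : Fin n →₀ ℕ) :
    ∃ S : P.HardySpace m →L[ℂ] P.HardySpace m,
      IsMultiplicationBy S fun z : P.triangle => ∏ i, hartogsMap z.1 i ^ α i := by
  -- Taking `T = 1` makes the commutation condition empty, leaving the algebra of all multipliers.
  have h : (∏ i, (fun z : P.triangle => hartogsMap z.1 i) ^ α i) ∈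
      commutingMultipliers (1 : P.HardySpace m →L[ℂ] P.HardySpace m) :=
    Subalgebra.prod_mem _ fun i _ => Subalgebra.pow_mem _ (by
      obtain ⟨S, hS⟩ := P.exists_isMultiplicationBy_hartogsMap m i
      exact ⟨S, hS, Commute.one_left S⟩) _
  obtain ⟨S, hS, -⟩ := h
  refine ⟨S, ?_⟩
  convert hS using 1
  ext z
  simp [Finset.prod_apply]

/-- The quotient of a function in the Hardy space by `∏_{j ≥ 2} 1 / z_j` is holomorphic. -/
theorem exists_differentiableOn_eq_div (g : P.HardySpace m) :
    ∃ F : (Fin n → ℂ) → ℂ, DifferentiableOn ℂ F P.triangle ∧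
      ∀ z : P.triangle, g z / P.weightVector m z = F z := by
  choose S hS using P.exists_isMultiplicationBy_monomial m
  let Q := P.denominator m
  -- The adjoint of `M_{D_w}`, expanded in monomials: conjugate-linearity turns the coefficients
  -- `conj (φ(w)^α)` into `φ(w)^α`, so `B` is holomorphic in `w`.
  let B : (Fin n → ℂ) → P.HardySpace m →L[ℂ] P.HardySpace m := fun z =>
    ∑ α ∈ Q.support, (conj (Q.coeff α) * ∏ i, hartogsMap z i ^ α i) • (S α).adjoint
  have hB : ∀ w : P.triangle, ∃ M : P.HardySpace m →L[ℂ] P.HardySpace m,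
      IsMultiplicationBy M (P.denominatorFun m w) ∧ IsUnit M ∧ M.adjoint = B w.1 := fun w => by
    obtain ⟨M, hM, uM⟩ := P.isUnitMultiplier_denominatorFun m w
    refine ⟨M, hM, uM, ?_⟩
    have h1 := IsMultiplicationBy.sum Q.support fun α _ =>
      (hS α).smul (Q.coeff α * conj (∏ i, hartogsMap w.1 i ^ α i))
    have h2 : P.denominatorFun m w = ∑ α ∈ Q.support, (Q.coeff α *
        conj (∏ i, hartogsMap w.1 i ^ α i)) • fun z : P.triangle => ∏ i, hartogsMap z.1 i ^ α i :=
      funext fun z => by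
        rw [denominatorFun_eq_eval, MvPolynomial.eval_eq', Finset.sum_apply]
        refine Finset.sum_congr rfl fun α _ => ?_
        simp only [mul_pow, Finset.prod_mul_distrib, map_prod, map_pow, Pi.smul_apply, smul_eq_mul]
        ring
    rw [← h2] at h1
    rw [hM.unique h1, map_sum]
    refine Finset.sum_congr rfl fun α _ => ?_
    rw [map_smulₛₗ, map_mul, Complex.conj_conj]
  -- From `M_{D_w} k_w = conj (u(w)) u` and `g(w) = ⟨k_w, g⟩` one gets `g(w) = u(w) ⟨u, B(w)⁻¹ g⟩`.
  -- Off the triangle `B` need not be invertible, and `Ring.inverse` then gives the harmless value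
  -- 0.
  refine ⟨fun z => inner ℂ (P.weightVector m) (Ring.inverse (B z) g), ?_, fun w => ?_⟩
  · have hdB : DifferentiableOn ℂ B P.triangle := by
      refine DifferentiableOn.fun_sum fun α _ => DifferentiableOn.smul_const ?_ _
      refine DifferentiableOn.const_mul ?_ _
      exact P.differentiableOn_prod_hartogsMap_pow _ _
    have hinv := hdB.inverse fun z hz => by
      obtain ⟨M, -, uM, h⟩ := hB ⟨z, hz⟩
      rw [← h]
      exact uM.star
    exact (innerSL ℂ (P.weightVector m)).differentiable.comp_differentiableOn
      (hinv.clm_apply (differentiableOn_const g))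
  · obtain ⟨M, hM, uM, h⟩ := hB w
    have huB : IsUnit (B w.1) := h ▸ uM.star
    refine div_eq_of_eq_mul (P.weightVector_ne_zero m w) ?_
    have h3 : B w.1 (Ring.inverse (B w.1) g) = g := by
      rw [← mul_apply_eq_comp, Ring.mul_inverse_cancel _ huB, one_apply_eq_self]
    calc g w = inner ℂ (RKHS.kerFun (P.HardySpace m) w (1 : ℂ))
          (M.adjoint (Ring.inverse (B w.1) g)) := by rw [h, h3, kerFun_one_inner]
      _ = _ := by
          rw [ContinuousLinearMap.adjoint_inner_right, P.apply_kerFun_of_isMultiplicationBy m hM,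
            inner_smul_left, Complex.conj_conj, weightVector_apply, mul_comm]

/-! ### The map into the bounded holomorphic functions, and the three conclusions -/

/-- The homomorphism from the commutant of `M_z` to the bounded holomorphic functions that sends
an operator to the function it multiplies by. -/
noncomputable def symbolHom (hz : ∀ j, IsMultiplier (P.HardySpace m) (P.coord j)) :
    commutant (P.multiplicationTuple m hz) →ₐ[ℂ] HInfty P.triangle where
  toFun T :=
    have h := P.exists_differentiableOn_eq_div m (T.1 (P.weightVector m))
    ⟨BoundedContinuousFunction.ofNormedAddCommGroup (P.symbol m T.1)
      (by
        obtain ⟨F, hF, hFs⟩ := h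
        exact (continuousOn_iff_continuous_domRestrict.1 hF.continuousOn).congr
          fun z => (hFs z).symm)
      ‖T.1‖
      (fun z => (P.isMultiplicationBy_symbol m T.2).norm_apply_le
        ⟨_, P.weightVector_ne_zero m z⟩), h⟩
  map_one' := Subtype.ext <| BoundedContinuousFunction.ext fun z =>
    div_self (P.weightVector_ne_zero m z)
  map_mul' S T := Subtype.ext <| BoundedContinuousFunction.ext fun z =>
    (congrFun (P.eq_symbol m ((P.isMultiplicationBy_symbol m S.2).mul
      (P.isMultiplicationBy_symbol m T.2))) z).symm
  map_zero' := Subtype.ext <| BoundedContinuousFunction.ext fun z =>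
    (congrFun (P.eq_symbol m IsMultiplicationBy.zero) z).symm
  map_add' S T := Subtype.ext <| BoundedContinuousFunction.ext fun z =>
    (congrFun (P.eq_symbol m ((P.isMultiplicationBy_symbol m S.2).add
      (P.isMultiplicationBy_symbol m T.2))) z).symm
  commutes' c := Subtype.ext <| BoundedContinuousFunction.ext fun z => by
    have h : IsMultiplicationBy (algebraMap ℂ (P.HardySpace m →L[ℂ] P.HardySpace m) c)
        (fun _ : P.triangle => c) := fun f x => by
      simp [Algebra.algebraMap_eq_smul_one]
    exact (congrFun (P.eq_symbol m h) z).symm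

theorem symbolHom_apply {hz : ∀ j, IsMultiplier (P.HardySpace m) (P.coord j)}
    (T : commutant (P.multiplicationTuple m hz)) (z : P.triangle) :
    (P.symbolHom m hz T).1 z = P.symbol m T.1 z :=
  rfl

theorem norm_symbolHom_le {hz : ∀ j, IsMultiplier (P.HardySpace m) (P.coord j)}
    (T : commutant (P.multiplicationTuple m hz)) : ‖P.symbolHom m hz T‖ ≤ ‖T‖ :=
  BoundedContinuousFunction.norm_ofNormedAddCommGroup_le _ (norm_nonneg _) fun z =>
    (P.isMultiplicationBy_symbol m T.2).norm_apply_le ⟨_, P.weightVector_ne_zero m z⟩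

theorem symbolHom_injective (hz : ∀ j, IsMultiplier (P.HardySpace m) (P.coord j)) :
    Function.Injective (P.symbolHom m hz) := fun S T h => by
  have hs : P.symbol m S.1 = P.symbol m T.1 := funext fun z => by
    rw [← symbolHom_apply, h, symbolHom_apply]
  exact Subtype.ext <| (P.isMultiplicationBy_symbol m S.2).unique
    (hs ▸ P.isMultiplicationBy_symbol m T.2)

/-- Multiplication operators commute, so the commutant is abelian and contains the `M_{z_j}`. An
abelian algebra containing it therefore consists of operators commuting with every `M_{z_j}`. -/
theorem isMaximalAbelian_commutant (hz : ∀ j, IsMultiplier (P.HardySpace m) (P.coord j)) :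
    IsMaximalAbelian (commutant (P.multiplicationTuple m hz)) := by
  refine ⟨fun S hS T hT =>
    (P.isMultiplicationBy_symbol m hS).commute (P.isMultiplicationBy_symbol m hT),
    fun A hA hle S hS => ?_⟩
  refine (Subalgebra.mem_centralizer_iff ℂ).2 ?_
  rintro _ ⟨j, rfl⟩
  refine hA _ (hle ((Subalgebra.mem_centralizer_iff ℂ).2 ?_)) S hS
  rintro _ ⟨i, rfl⟩
  exact (isMultiplicationBy_multiplicationOperator (hz i)).commute
    (isMultiplicationBy_multiplicationOperator (hz j))

theorem commutant_eq_multiplierAlgebra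
    (hz : ∀ j, IsMultiplier (P.HardySpace m) (P.coord j)) :
    commutant (P.multiplicationTuple m hz) = multiplierAlgebra (P.HardySpace m) := by
  refine le_antisymm (fun T hT => ?_) ?_
  · have h := P.isMultiplicationBy_symbol m hT
    exact ⟨_, h.isMultiplier, h.unique (isMultiplicationBy_multiplicationOperator _)⟩
  · rintro _ ⟨φ, hφ, rfl⟩
    refine (Subalgebra.mem_centralizer_iff ℂ).2 ?_
    rintro _ ⟨j, rfl⟩
    exact (isMultiplicationBy_multiplicationOperator (hz j)).commute
      (isMultiplicationBy_multiplicationOperator hφ)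

end PositiveRegularTuple

theorem mainTheorem2 (n : ℕ) (hn : 2 ≤ n) (P : PositiveRegularTuple n) (m : Fin n → ℕ+) :
    -- the coordinate functions are multipliers, so `M_z` is a tuple of bounded operators
    ∃ hz : ∀ j, IsMultiplier (P.HardySpace m) (P.coord j),
      IsMaximalAbelian (commutant (P.multiplicationTuple m hz)) ∧
      commutant (P.multiplicationTuple m hz) = multiplierAlgebra (P.HardySpace m) ∧
      ∃ Φ : commutant (P.multiplicationTuple m hz) →ₐ[ℂ] HInfty P.triangle,
        Function.Injective Φ ∧
        (∀ T, ‖Φ T‖ ≤ ‖T‖) ∧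
        ∀ T (f : P.HardySpace m) (z : P.triangle), T.1 f z = (Φ T).1 z * f z := by
  have hz := P.isMultiplier_coord m
  exact ⟨hz, P.isMaximalAbelian_commutant m hz, P.commutant_eq_multiplierAlgebra m hz,
    P.symbolHom m hz, P.symbolHom_injective m hz, P.norm_symbolHom_le m,
    fun T => P.isMultiplicationBy_symbol m T.2⟩
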